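/- Let $\mathbb{H}_n$ denote the set of $n\times n$ complex Hermitian matrices and $\|\cdot\|$ the operator norm induced by the Euclidean norm. Let $A_0\in\mathbb{H}_n$ have rank $m$ and put $l=n-m$. Then there are radii $r_A,r_E>0$ and a constant $c>0$ such that the following holds. Let $A\in\mathbb{H}_n$ have rank $m$ with $\|A-A_0\|<r_A$, let $E\in\mathbb{H}_n$ with $\|E\|<r_E$, and let $$A=U\begin{pmatrix}0&0\\0&\Lambda_\tau\end{pmatrix}U^*$$ be any spectral decomposition of $A$ with $U$ unitary and $\Lambda_\tau$ the $m\times m$ diagonal matrix of the nonzero eigenvalues of $A$. Write $$U^*EU=\hat E=\begin{pmatrix}\hat E_{11}&C\\C^*&\hat E_{22}\end{pmatrix}$$ in the same block structure (so $\hat E_{11}$ is $l\times l$), and let $\tilde\beta_1,\dots,\tilde\beta_l$ be the eigenvalues, counted with multiplicity, of $$\tilde B=\hat E_{11}-C\Lambda_\tau^{-1}C^*.$$ Then the eigenvalues $\xi_1,\dots,\xi_n$ of $A+E$, counted with multiplicity, can be ordered in such a way that for all $1\le j\le l$ $$|\xi_j-\tilde\beta_j|\le c\|E\|^3,$$ with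 strict inequality whenever $E\ne0$. -/

import Mathlib

open scoped Matrix

noncomputable section

namespace HermPert

/-- `A = U diag(0_l, Λ_τ) U*` with `U = [U₁ U₂]` unitary: the columns of `U`, indexed by
`Fin l ⊕ Fin m`, are orthonormal eigenvectors of `A`, the first `l` belonging to the
eigenvalue `0` and the last `m` to the eigenvalues `τ`. When `A` has rank `m` all the `τ i`
are nonzero, so that `U₁` spans the kernel of `A`. -/
def IsSpectralDecomp {n l m : ℕ} (A : Matrix (Fin n) (Fin n) ℂ)
    (U : Matrix (Fin n) (Fin l ⊕ Fin m) ℂ) (τ : Fin m → ℝ) : Prop :=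
  Uᴴ * U = 1 ∧ U * Uᴴ = 1 ∧
    A = U * (Matrix.fromBlocks 0 0 0 (Matrix.diagonal fun i => (τ i : ℂ)) :
      Matrix (Fin l ⊕ Fin m) (Fin l ⊕ Fin m) ℂ) * Uᴴ

/-- The perturbation in the eigenbasis, `Ê = U* E U`. -/
def hatE {n l m : ℕ} (U : Matrix (Fin n) (Fin l ⊕ Fin m) ℂ) (E : Matrix (Fin n) (Fin n) ℂ) :
    Matrix (Fin l ⊕ Fin m) (Fin l ⊕ Fin m) ℂ :=
  Uᴴ * E * U

/-- The block `C = Ê₁₂`. -/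
def blockC {n l m : ℕ} (U : Matrix (Fin n) (Fin l ⊕ Fin m) ℂ) (E : Matrix (Fin n) (Fin n) ℂ) :
    Matrix (Fin l) (Fin m) ℂ :=
  (hatE U E).toBlocks₁₂

/-- The simplified Schur complement `B̃ = Ê₁₁ - C Λ_τ⁻¹ C*`. -/
def tildeB {n l m : ℕ} (U : Matrix (Fin n) (Fin l ⊕ Fin m) ℂ) (τ : Fin m → ℝ)
    (E : Matrix (Fin n) (Fin n) ℂ) : Matrix (Fin l) (Fin l) ℂ :=
  (hatE U E).toBlocks₁₁ -
    blockC U E * (Matrix.diagonal fun i => (τ i : ℂ))⁻¹ * (blockC U E)ᴴ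

theorem isHermitian_tildeB {n l m : ℕ} (U : Matrix (Fin n) (Fin l ⊕ Fin m) ℂ) (τ : Fin m → ℝ)
    {E : Matrix (Fin n) (Fin n) ℂ} (hE : E.IsHermitian) : (tildeB U τ E).IsHermitian := by
  have h1 : (hatE U E).IsHermitian := Matrix.isHermitian_conjTranspose_mul_mul U hE
  have h2 : (Matrix.diagonal fun i => (τ i : ℂ)).IsHermitian :=
    Matrix.isHermitian_diagonal_of_self_adjoint _ (by
      ext i; simp)
  refine Matrix.IsHermitian.sub ?_ (Matrix.isHermitian_mul_mul_conjTranspose _ h2.inv)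
  ext i j
  exact congrFun (congrFun h1 (Sum.inl i)) (Sum.inl j)

end HermPert

end

-- ‖·‖ on matrices is the operator norm induced by the Euclidean norm.
open scoped Matrix.Norms.L2Operator

namespace HermPert

/-! In the eigenbasis of `A`, the matrix `A + E` is the block matrix with diagonal blocks `Ê₁₁`, `Λ
+ Ê₂₂` and off-diagonal blocks `C`, `Cᴴ`. For a shift `x` of size O(‖E‖), the block `D = Λ + Ê₂₂ -
x` is invertible, and completing the square splits the form of `A + E - x` into that of `D` and that
of the Schur complement `Ê₁₁ - x - C D⁻¹ Cᴴ`. Replacing `D⁻¹` by `Λ⁻¹` costs ‖C‖² · O(‖E‖) = O(‖E‖³)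
and turns the latter into `B̃ - x`.

A Courant–Fischer dimension count (`card_le_of_form`) converts this into an inequality between
counting functions, `card_add_card_pos_le`; applying it to the negated data gives the reverse bound.
Together they place the sorted eigenvalues of `B̃` next to a consecutive block of sorted eigenvalues
of `A + E` (`exists_perm_of_card_le`). The constants are uniform in `A` because its nonzero
eigenvalues stay a fixed distance from zero (`exists_gap`). -/

/-! ### Matching families of reals through their counting functions. -/

open Finset in
/-- If the counting functions of two families of reals are interlaced up to a tolerance `ε`, then
the shorter family can be matched injectively with part of the longer one. -/
theorem exists_perm_of_card_le {n l p q : ℕ} (hln : l ≤ n) (h : p + q + l = n)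
    (lam : Fin n → ℝ) (β : Fin l → ℝ) (ε : ℝ)
    (hge : ∀ j, #{k | β j ≤ β k} + q ≤ #{i | β j - ε ≤ lam i})
    (hle : ∀ j, #{k | β k ≤ β j} + p ≤ #{i | lam i ≤ β j + ε}) :
    ∃ σ : Equiv.Perm (Fin n), ∀ j : Fin l, |lam (σ (Fin.castLE hln j)) - β j| ≤ ε := by
  classical
  -- The `k`-th smallest `β` is paired with the `(p + k)`-th smallest `lam`, leaving `p` values
  -- below the matched block and `q` above it.
  let g : Fin l → Fin n := fun j =>
    Tuple.sort lam ⟨p + (Tuple.sort β).symm j, by have := ((Tuple.sort β).symm j).2; omega⟩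
  have hg : Function.Injective g := by
    intro a b hab
    simpa [g, ← Fin.ext_iff] using hab
  obtain ⟨σ, hσ⟩ : ∃ σ : Equiv.Perm (Fin n), ∀ j : Fin l, σ (Fin.castLE hln j) = g j := by
    let e : {i // i ∈ Set.range (Fin.castLE hln)} ≃ {i // i ∈ Set.range g} :=
      (Equiv.ofInjective _ (Fin.castLE_injective hln)).symm.trans (Equiv.ofInjective g hg)
    refine ⟨e.extendSubtype, fun j => ?_⟩
    rw [e.extendSubtype_apply_of_mem _ ⟨j, rfl⟩]
    exact congrArg Subtype.val (congrArg (Equiv.ofInjective g hg)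
      (Equiv.ofInjective_symm_apply (Fin.castLE_injective hln) j))
  refine ⟨σ, fun j => ?_⟩
  rw [hσ]
  obtain ⟨k, rfl⟩ := (Tuple.sort β).surjective j
  have hmβ := Tuple.monotone_sort β
  have hml := Tuple.monotone_sort lam
  have hk := k.2
  simp only [g, Equiv.symm_apply_apply]
  set i₀ : Fin n := ⟨p + k, by omega⟩ with hi₀
  have h1 := hge (Tuple.sort β k)
  have h2 := hle (Tuple.sort β k)
  have c1 : l - k ≤ #{k' | β (Tuple.sort β k) ≤ β k'} := by
    rw [← Fin.card_Ici, ← card_map (Tuple.sort β).toEmbedding]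
    refine card_le_card fun a ha => ?_
    simp only [mem_map, mem_Ici, Equiv.coe_toEmbedding] at ha
    obtain ⟨b, hb, rfl⟩ := ha
    simpa using hmβ hb
  have c2 : (k : ℕ) + 1 ≤ #{k' | β k' ≤ β (Tuple.sort β k)} := by
    rw [← Fin.card_Iic, ← card_map (Tuple.sort β).toEmbedding]
    refine card_le_card fun a ha => ?_
    simp only [mem_map, mem_Iic, Equiv.coe_toEmbedding] at ha
    obtain ⟨b, hb, rfl⟩ := ha
    simpa using hmβ hb
  rw [abs_le]
  constructor
  -- Otherwise every `lam i ≥ β - ε` ranks strictly above `p + k`, which leaves at most `n - 1 - p -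
  -- k = q + l - k - 1` of them, one too few.
  · by_contra hcon
    have : #{i | β (Tuple.sort β k) - ε ≤ lam i} ≤ #((Ioi i₀).map (Tuple.sort lam).toEmbedding) := by
      refine card_le_card fun a ha => ?_
      obtain ⟨b, rfl⟩ := (Tuple.sort lam).surjective a
      simp only [mem_filter, mem_univ, true_and] at ha
      simp only [mem_map, mem_Ioi, Equiv.coe_toEmbedding, EmbeddingLike.apply_eq_iff_eq,
        exists_eq_right]
      by_contra hb
      have := hml (not_lt.1 hb)
      simp only [Function.comp] at this
      linarith
    rw [card_map, Fin.card_Ioi] at this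
    simp only [hi₀] at this
    omega
  · by_contra hcon
    have : #{i | lam i ≤ β (Tuple.sort β k) + ε} ≤ #((Iio i₀).map (Tuple.sort lam).toEmbedding) := by
      refine card_le_card fun a ha => ?_
      obtain ⟨b, rfl⟩ := (Tuple.sort lam).surjective a
      simp only [mem_filter, mem_univ, true_and] at ha
      simp only [mem_map, mem_Iio, Equiv.coe_toEmbedding, EmbeddingLike.apply_eq_iff_eq,
        exists_eq_right]
      by_contra hb
      have := hml (not_lt.1 hb)
      simp only [Function.comp] at this
      linarith
    rw [card_map, Fin.card_Iio] at this
    simp only [hi₀] at this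
    omega

/-! ### Quadratic forms and the Courant–Fischer count. -/

/-- Squared Euclidean norm of a complex vector. -/
noncomputable def normSqVec {ι : Type*} [Fintype ι] (v : ι → ℂ) : ℝ := ∑ i, ‖v i‖ ^ 2

section
variable {ι κ μ : Type*} [Fintype ι] [Fintype κ] [Fintype μ]

theorem normSqVec_nonneg (v : ι → ℂ) : 0 ≤ normSqVec v := by
  unfold normSqVec; positivity

theorem normSqVec_eq_norm_sq (v : ι → ℂ) : normSqVec v = ‖WithLp.toLp 2 v‖ ^ 2 := by
  rw [EuclideanSpace.norm_sq_eq]; rfl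

theorem star_dotProduct_self (v : ι → ℂ) : star v ⬝ᵥ v = (normSqVec v : ℂ) := by
  simp [dotProduct, normSqVec, Complex.conj_mul']

theorem star_mulVec_dotProduct (M : Matrix ι κ ℂ) (v : κ → ℂ) (w : ι → ℂ) :
    star (M *ᵥ v) ⬝ᵥ w = star v ⬝ᵥ (Mᴴ *ᵥ w) := by
  rw [Matrix.star_mulVec, Matrix.dotProduct_mulVec]

theorem normSqVec_mulVec [DecidableEq κ] {M : Matrix ι κ ℂ} (hM : Mᴴ * M = 1) (v : κ → ℂ) :
    normSqVec (M *ᵥ v) = normSqVec v := by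
  have : ((normSqVec (M *ᵥ v) : ℝ) : ℂ) = normSqVec v := by
    rw [← star_dotProduct_self, star_mulVec_dotProduct, Matrix.mulVec_mulVec, hM,
      Matrix.one_mulVec, star_dotProduct_self]
  exact_mod_cast this

theorem abs_re_form_le [DecidableEq ι] (M : Matrix ι ι ℂ) (v : ι → ℂ) :
    |(star v ⬝ᵥ (M *ᵥ v)).re| ≤ ‖M‖ * normSqVec v := by
  have h : star v ⬝ᵥ (M *ᵥ v) = inner ℂ (WithLp.toLp 2 v) (WithLp.toLp 2 (M *ᵥ v)) := by
    rw [EuclideanSpace.inner_toLp_toLp, dotProduct_comm]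
  rw [h]
  refine (Complex.abs_re_le_norm _).trans ((norm_inner_le_norm _ _).trans ?_)
  have := Matrix.l2_opNorm_mulVec M (WithLp.toLp 2 v)
  rw [normSqVec_eq_norm_sq]
  calc _ ≤ ‖WithLp.toLp 2 v‖ * (‖M‖ * ‖WithLp.toLp 2 v‖) :=
        mul_le_mul_of_nonneg_left this (norm_nonneg _)
    _ = _ := by ring

theorem re_diagonal_form [DecidableEq ι] (d : ι → ℝ) (v : ι → ℂ) :
    (star v ⬝ᵥ ((Matrix.diagonal fun i => (d i : ℂ)) *ᵥ v)).re = ∑ i, d i * ‖v i‖ ^ 2 := by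
  simp only [dotProduct, Matrix.mulVec_diagonal, Complex.re_sum, Pi.star_apply, RCLike.star_def]
  refine Finset.sum_congr rfl fun i _ => ?_
  rw [mul_left_comm, Complex.conj_mul', Complex.re_ofReal_mul]
  norm_cast

theorem norm_le_one_of_isometry [DecidableEq κ] {M : Matrix ι κ ℂ} (hM : Mᴴ * M = 1) :
    ‖M‖ ≤ 1 := by
  have h := Matrix.l2_opNorm_conjTranspose_mul_self M
  rw [hM] at h
  have h1 : ‖(1 : Matrix κ κ ℂ)‖ ≤ 1 := by
    rw [← Matrix.diagonal_one, Matrix.l2_opNorm_diagonal]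
    exact (pi_norm_le_iff_of_nonneg zero_le_one).2 fun i => by simp
  nlinarith [norm_nonneg M]

open Finset in
/-- Half of the Courant–Fischer principle, in counting form: a subspace on which the form of `H`
dominates `x` times the norm has dimension at most the number of eigenvalues `≥ x`. -/
theorem card_le_of_form [DecidableEq ι] [DecidableEq κ] [DecidableEq μ]
    {H : Matrix μ μ ℂ} {V : Matrix μ ι ℂ}
    (hV1 : Vᴴ * V = 1) (hV2 : V * Vᴴ = 1) (d : ι → ℝ)
    (hH : H = V * (Matrix.diagonal fun i => (d i : ℂ)) * Vᴴ) (x : ℝ) (F : Matrix μ κ ℂ)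
    (hF : ∀ g, F *ᵥ g = 0 → g = 0)
    (hform : ∀ g, x * normSqVec (F *ᵥ g) ≤ (star (F *ᵥ g) ⬝ᵥ (H *ᵥ (F *ᵥ g))).re) :
    Fintype.card κ ≤ #{i | x ≤ d i} := by
  by_contra hlt
  -- A nonzero kernel vector of `L` gives a vector of the subspace with components only along
  -- eigenvalues `< x`, where the form is strictly too small.
  let L : (κ → ℂ) →ₗ[ℂ] ({i // x ≤ d i} → ℂ) :=
    (LinearMap.funLeft ℂ ℂ Subtype.val).comp (Vᴴ * F).mulVecLin
  have hker : LinearMap.ker L ≠ ⊥ := by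
    apply LinearMap.ker_ne_bot_of_finrank_lt
    rw [Module.finrank_fintype_fun_eq_card, Module.finrank_fintype_fun_eq_card,
      Fintype.card_subtype]
    omega
  obtain ⟨g, hg, hg0⟩ := (Submodule.ne_bot_iff _).1 hker
  have hw : ∀ i, x ≤ d i → (Vᴴ *ᵥ (F *ᵥ g)) i = 0 := fun i hi => by
    have := congrFun (LinearMap.mem_ker.1 hg) ⟨i, hi⟩
    simpa [L, LinearMap.funLeft] using this
  set w := Vᴴ *ᵥ (F *ᵥ g) with hwdef
  have hVw : V *ᵥ w = F *ᵥ g := by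
    rw [hwdef, Matrix.mulVec_mulVec, hV2, Matrix.one_mulVec]
  have hw0 : w ≠ 0 := fun h => hg0 (hF g (by rw [← hVw, h, Matrix.mulVec_zero]))
  have h1 := hform g
  rw [← hVw, normSqVec_mulVec hV1, star_mulVec_dotProduct, hH, Matrix.mulVec_mulVec,
    Matrix.mulVec_mulVec] at h1
  have e : Vᴴ * (V * (Matrix.diagonal fun i => (d i : ℂ)) * Vᴴ) * V =
      Matrix.diagonal fun i => (d i : ℂ) := by
    rw [Matrix.mul_assoc, Matrix.mul_assoc, hV1, Matrix.mul_one, ← Matrix.mul_assoc, hV1,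
      Matrix.one_mul]
  rw [e, re_diagonal_form, normSqVec, mul_sum] at h1
  refine absurd h1 (not_le.2 ?_)
  obtain ⟨i, hi⟩ := Function.ne_iff.1 hw0
  refine sum_lt_sum (fun k _ => ?_) ⟨i, mem_univ _, ?_⟩
  · by_cases hk : x ≤ d k
    · simp [hw k hk]
    · exact mul_le_mul_of_nonneg_right (not_le.1 hk).le (by positivity)
  · have hi' : ¬ x ≤ d i := fun hk => hi (hw i hk)
    have : 0 < ‖w i‖ := norm_pos_iff.2 hi
    exact mul_lt_mul_of_pos_right (not_le.1 hi') (by positivity)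

end

/-! ### Norm bounds for inverses, submatrices and diagonal forms. -/

section
variable {ι κ μ : Type*} [Fintype ι] [Fintype κ] [Fintype μ]

theorem norm_inv_diagonal_le [DecidableEq κ] {τ : κ → ℝ} {δ : ℝ} (hδ : 0 < δ)
    (hτ : ∀ i, δ ≤ |τ i|) : ‖(Matrix.diagonal fun i => (τ i : ℂ))⁻¹‖ ≤ 1 / δ := by
  have hτ0 : ∀ i, (τ i : ℂ) ≠ 0 := fun i h => by
    have := hτ i
    rw [Complex.ofReal_eq_zero.1 h, abs_zero] at this
    linarith
  have : (Matrix.diagonal fun i => (τ i : ℂ))⁻¹ = Matrix.diagonal fun i => (τ i : ℂ)⁻¹ := by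
    apply Matrix.inv_eq_right_inv
    rw [Matrix.diagonal_mul_diagonal, ← Matrix.diagonal_one]
    congr 1
    funext i
    exact mul_inv_cancel₀ (hτ0 i)
  rw [this, Matrix.l2_opNorm_diagonal]
  refine (pi_norm_le_iff_of_nonneg (by positivity)).2 fun i => ?_
  rw [norm_inv, Complex.norm_real, Real.norm_eq_abs, one_div]
  exact inv_anti₀ hδ (hτ i)

/-- Writing `L` for the diagonal matrix, `L + N = L (1 + L⁻¹ N)` with `‖L⁻¹ N‖ ≤ 1/2`. The resolvent
identity `(L + N)⁻¹ - L⁻¹ = -L⁻¹ N (L + N)⁻¹` first bounds `‖(L + N)⁻¹‖` by `2 / δ`, half of the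
norm being absorbed, and then bounds the difference. -/
theorem isUnit_and_norm_inv_le [DecidableEq κ] {τ : κ → ℝ} {δ : ℝ} (hδ : 0 < δ)
    (hτ : ∀ i, δ ≤ |τ i|) {N : Matrix κ κ ℂ} (hN : ‖N‖ ≤ δ / 2) :
    IsUnit ((Matrix.diagonal fun i => (τ i : ℂ)) + N) ∧
    ‖((Matrix.diagonal fun i => (τ i : ℂ)) + N)⁻¹ - (Matrix.diagonal fun i => (τ i : ℂ))⁻¹‖ ≤
      2 / δ ^ 2 * ‖N‖ := by
  have hτ0 : ∀ i, (τ i : ℂ) ≠ 0 := fun i h => by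
    have := hτ i
    rw [Complex.ofReal_eq_zero.1 h, abs_zero] at this
    linarith
  set L : Matrix κ κ ℂ := Matrix.diagonal fun i => (τ i : ℂ) with hL
  have hLu : IsUnit L.det := by
    rw [hL, Matrix.det_diagonal, isUnit_iff_ne_zero, Finset.prod_ne_zero_iff]
    exact fun i _ => hτ0 i
  have hLn : ‖L⁻¹‖ ≤ 1 / δ := norm_inv_diagonal_le hδ hτ
  have hLN : ‖L⁻¹ * N‖ ≤ 1 / 2 := by
    refine (norm_mul_le _ _).trans ?_
    calc ‖L⁻¹‖ * ‖N‖ ≤ 1 / δ * (δ / 2) := by gcongr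
      _ = 1 / 2 := by field_simp
  have hu : IsUnit (L + N) := by
    have h1 : L + N = L * (1 - -(L⁻¹ * N)) := by
      rw [sub_neg_eq_add, mul_add, mul_one, ← mul_assoc, Matrix.mul_nonsing_inv _ hLu, one_mul]
    rw [h1]
    refine ((Matrix.isUnit_iff_isUnit_det _).2 hLu).mul ?_
    have hlt : ‖-(L⁻¹ * N)‖ < 1 := by rw [norm_neg]; linarith
    have : CompleteSpace (Matrix κ κ ℂ) := FiniteDimensional.complete ℂ _
    exact isUnit_one_sub_of_norm_lt_one hlt
  have hud := (Matrix.isUnit_iff_isUnit_det _).1 hu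
  have hG : (L + N)⁻¹ - L⁻¹ = -(L⁻¹ * N * (L + N)⁻¹) := by
    have h2 : L⁻¹ * (L + N) * (L + N)⁻¹ = L⁻¹ := by
      rw [mul_assoc, Matrix.mul_nonsing_inv _ hud, mul_one]
    have h3 : L⁻¹ * (L + N) * (L + N)⁻¹ = (L + N)⁻¹ + L⁻¹ * N * (L + N)⁻¹ := by
      rw [mul_add, Matrix.nonsing_inv_mul _ hLu, add_mul, one_mul]
    rw [h3] at h2
    exact sub_eq_of_eq_add (by rw [neg_add_eq_sub]; exact eq_sub_of_add_eq h2)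
  have hGn : ‖(L + N)⁻¹‖ ≤ 2 / δ := by
    have h4 : (L + N)⁻¹ = L⁻¹ - L⁻¹ * N * (L + N)⁻¹ := by
      rw [sub_eq_add_neg, ← hG]; abel
    have h5 : ‖(L + N)⁻¹‖ ≤ 1 / δ + 1 / 2 * ‖(L + N)⁻¹‖ := by
      conv_lhs => rw [h4]
      refine (norm_sub_le _ _).trans (add_le_add hLn ((norm_mul_le _ _).trans ?_))
      gcongr
    have : 2 / δ = 2 * (1 / δ) := by ring
    linarith
  refine ⟨hu, ?_⟩
  rw [hG, norm_neg]
  calc ‖L⁻¹ * N * (L + N)⁻¹‖ ≤ ‖L⁻¹‖ * ‖N‖ * ‖(L + N)⁻¹‖ :=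
        (norm_mul_le _ _).trans (by gcongr; exact norm_mul_le _ _)
    _ ≤ 1 / δ * ‖N‖ * (2 / δ) := by gcongr
    _ = _ := by ring

theorem abs_le_norm_of_unitary_diag [DecidableEq ι] {W B : Matrix ι ι ℂ} (hW : Wᴴ * W = 1)
    {β : ι → ℝ} (hB : B = W * (Matrix.diagonal fun i => (β i : ℂ)) * Wᴴ) (j : ι) : |β j| ≤ ‖B‖ := by
  have h : (Matrix.diagonal fun i => (β i : ℂ)) = Wᴴ * B * W := by
    rw [hB, Matrix.mul_assoc, Matrix.mul_assoc, hW, Matrix.mul_one, ← Matrix.mul_assoc, hW,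
      Matrix.one_mul]
  have h1 := norm_le_one_of_isometry hW
  have h2 : ‖Matrix.diagonal fun i => (β i : ℂ)‖ ≤ ‖B‖ := by
    rw [h]
    refine (norm_mul_le _ _).trans ?_
    have h3 := norm_mul_le Wᴴ B
    rw [Matrix.l2_opNorm_conjTranspose] at h3
    have := norm_nonneg B
    have := norm_nonneg W
    have := norm_nonneg (Wᴴ * B)
    nlinarith
  rw [Matrix.l2_opNorm_diagonal] at h2
  have := (norm_le_pi_norm (fun i => (β i : ℂ)) j).trans h2
  simpa using this

/-- Distinct columns of the identity form an isometry. -/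
theorem submatrix_one_isometry {ν : Type*} [DecidableEq ι] [DecidableEq ν] {f : ν → ι}
    (hf : Function.Injective f) :
    ((1 : Matrix ι ι ℂ).submatrix id f)ᴴ * (1 : Matrix ι ι ℂ).submatrix id f = 1 := by
  ext a b
  simp [Matrix.mul_apply, Matrix.one_apply, hf.eq_iff]

theorem norm_submatrix_le {ν ρ : Type*} [Fintype ν] [Fintype ρ] [DecidableEq ν] [DecidableEq ρ]
    [DecidableEq ι] [DecidableEq κ] (M : Matrix ι κ ℂ) {f : ν → ι} {g : ρ → κ}
    (hf : Function.Injective f) (hg : Function.Injective g) : ‖M.submatrix f g‖ ≤ ‖M‖ := by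
  have h : M.submatrix f g =
      ((1 : Matrix ι ι ℂ).submatrix id f)ᴴ * M * (1 : Matrix κ κ ℂ).submatrix id g := by
    ext a b
    simp [Matrix.mul_apply, Matrix.one_apply]
  have h1 := norm_le_one_of_isometry (submatrix_one_isometry hf)
  have h2 := norm_le_one_of_isometry (submatrix_one_isometry hg)
  rw [← Matrix.l2_opNorm_conjTranspose] at h1
  rw [h]
  calc _ ≤ ‖((1 : Matrix ι ι ℂ).submatrix id f)ᴴ‖ * ‖M‖ *
          ‖(1 : Matrix κ κ ℂ).submatrix id g‖ :=
        (Matrix.l2_opNorm_mul _ _).trans (by gcongr; exact Matrix.l2_opNorm_mul _ _)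
    _ ≤ 1 * ‖M‖ * 1 := by gcongr
    _ = ‖M‖ := by ring

theorem submatrix_one_mulVec_apply_of_not {ν : Type*} [DecidableEq ν] (p : ν → Prop)
    [Fintype {i // p i}] (g : {i // p i} → ℂ) {i : ν} (hi : ¬ p i) :
    ((1 : Matrix ν ν ℂ).submatrix id (Subtype.val : {i // p i} → ν) *ᵥ g) i = 0 := by
  simp only [Matrix.mulVec, dotProduct, Matrix.submatrix_apply]
  refine Finset.sum_eq_zero fun a _ => ?_
  have h : i ≠ a := by rintro rfl; exact hi a.2
  rw [id, Matrix.one_apply_ne h, zero_mul]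

theorem mul_normSqVec_le_diagonal_form [DecidableEq ι] (d : ι → ℝ) (y : ℝ) (v : ι → ℂ)
    (h : ∀ i, d i < y → v i = 0) :
    y * normSqVec v ≤ (star v ⬝ᵥ ((Matrix.diagonal fun i => (d i : ℂ)) *ᵥ v)).re := by
  rw [re_diagonal_form, normSqVec, Finset.mul_sum]
  refine Finset.sum_le_sum fun i _ => ?_
  by_cases hi : d i < y
  · simp [h i hi]
  · exact mul_le_mul_of_nonneg_right (not_lt.1 hi) (by positivity)

theorem normSqVec_eq_zero {v : ι → ℂ} : normSqVec v = 0 ↔ v = 0 := by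
  rw [normSqVec_eq_norm_sq, sq_eq_zero_iff, norm_eq_zero, WithLp.toLp_eq_zero]

end

/-! ### The Schur complement count. -/

open Finset in
/-- Counting form of the Schur complement argument: up to an error of third order, the eigenvalues
of the simplified Schur complement bound from below those of the block matrix, shifted by the
number of positive `τ i`. -/
theorem card_add_card_pos_le {α κ ι : Type*} [Fintype α] [Fintype κ] [Fintype ι] [DecidableEq α]
    [DecidableEq κ] [DecidableEq ι] {E₁₁ W : Matrix α α ℂ} {C : Matrix α κ ℂ} {E₂₂ : Matrix κ κ ℂ}
    {τ : κ → ℝ} {β : α → ℝ} {V : Matrix (α ⊕ κ) ι ℂ} {lam : ι → ℝ} {δ e : ℝ} (hδ : 0 < δ)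
    (hτ : ∀ i, δ ≤ |τ i|) (he0 : 0 ≤ e) (he : e ≤ δ / 8) (h₁₁ : ‖E₁₁‖ ≤ e) (hC : ‖C‖ ≤ e)
    (h₂₂ : ‖E₂₂‖ ≤ e) (hE₂₂ : E₂₂.IsHermitian) (hW1 : Wᴴ * W = 1)
    (hB : E₁₁ - C * (Matrix.diagonal fun i => (τ i : ℂ))⁻¹ * Cᴴ =
      W * (Matrix.diagonal fun i => (β i : ℂ)) * Wᴴ)
    (hV1 : Vᴴ * V = 1) (hV2 : V * Vᴴ = 1)
    (hH : Matrix.fromBlocks E₁₁ C Cᴴ ((Matrix.diagonal fun i => (τ i : ℂ)) + E₂₂) =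
      V * (Matrix.diagonal fun i => (lam i : ℂ)) * Vᴴ) (j : α) :
    #{k | β j ≤ β k} + #{i | 0 < τ i} ≤ #{i | β j - 8 / δ ^ 2 * e ^ 3 ≤ lam i} := by
  set L : Matrix κ κ ℂ := Matrix.diagonal fun i => (τ i : ℂ) with hL
  set ε := 8 / δ ^ 2 * e ^ 3 with hε
  set x := β j - ε with hx
  have hCn : ‖Cᴴ‖ ≤ e := by rwa [Matrix.l2_opNorm_conjTranspose]
  have hε0 : 0 ≤ ε := by positivity
  have hεe : ε ≤ e := by
    have : e ^ 2 ≤ δ ^ 2 / 64 := by nlinarith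
    calc ε = 8 / δ ^ 2 * e ^ 2 * e := by rw [hε]; ring
      _ ≤ 8 / δ ^ 2 * (δ ^ 2 / 64) * e := by gcongr
      _ = e / 8 := by field_simp; norm_num
      _ ≤ e := by linarith
  have hβ : |β j| ≤ 2 * e := by
    refine (abs_le_norm_of_unitary_diag hW1 hB j).trans ((norm_sub_le _ _).trans ?_)
    have h1 : ‖C * L⁻¹ * Cᴴ‖ ≤ e := by
      calc ‖C * L⁻¹ * Cᴴ‖ ≤ ‖C‖ * ‖L⁻¹‖ * ‖Cᴴ‖ :=
            (Matrix.l2_opNorm_mul _ _).trans (by gcongr; exact Matrix.l2_opNorm_mul _ _)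
        _ ≤ e * (1 / δ) * (δ / 8) := by
            gcongr
            · exact norm_inv_diagonal_le hδ hτ
            · exact hCn.trans he
        _ = e / 8 := by field_simp
        _ ≤ e := by linarith
    linarith
  have hxe : |x| ≤ 3 * e := by
    rw [abs_le] at hβ ⊢
    constructor <;> linarith [hβ.1, hβ.2]
  set N : Matrix κ κ ℂ := E₂₂ - (x : ℂ) • 1 with hNdef
  have hN : ‖N‖ ≤ 4 * e := by
    refine (norm_sub_le _ _).trans ?_
    have h1 : ‖(1 : Matrix κ κ ℂ)‖ ≤ 1 := norm_le_one_of_isometry (by simp)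
    have h2 : ‖(x : ℂ) • (1 : Matrix κ κ ℂ)‖ ≤ 3 * e := by
      rw [norm_smul, Complex.norm_real, Real.norm_eq_abs]
      calc |x| * ‖(1 : Matrix κ κ ℂ)‖ ≤ |x| * 1 := by gcongr
        _ ≤ _ := by linarith
    linarith
  have hNδ : ‖N‖ ≤ δ / 2 := by linarith
  obtain ⟨hDu, hDn⟩ := isUnit_and_norm_inv_le hδ hτ hNδ
  rw [← hL] at hDu hDn
  set D := L + N with hD
  have hDh : D.IsHermitian := by
    refine (Matrix.isHermitian_diagonal_of_self_adjoint _ (by ext i; simp)).add (hE₂₂.sub ?_)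
    rw [Matrix.IsHermitian, Matrix.conjTranspose_smul]
    simp
  have := hDu.invertible
  let P : Matrix κ {i // 0 < τ i} ℂ := (1 : Matrix κ κ ℂ).submatrix id Subtype.val
  let Q : Matrix α {k // β j ≤ β k} ℂ := (1 : Matrix α α ℂ).submatrix id Subtype.val
  have hP : Pᴴ * P = 1 := submatrix_one_isometry Subtype.val_injective
  have hQ : Qᴴ * Q = 1 := submatrix_one_isometry Subtype.val_injective
  -- The test vectors are `(a, b - D⁻¹ Cᴴ a)`, with `a` spanned by eigenvectors of `B̃` for `β k ≥ β
  -- j` and `b` supported where `τ > 0`. The correction `-D⁻¹ Cᴴ a` removes the cross terms, so the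
  -- shifted form becomes `b* D b + a* S a`.
  let F : Matrix (α ⊕ κ) ({k // β j ≤ β k} ⊕ {i // 0 < τ i}) ℂ :=
    Matrix.fromBlocks (W * Q) 0 (-(D⁻¹ * Cᴴ * (W * Q))) P
  have hFg : ∀ g, F *ᵥ g = Sum.elim (W *ᵥ (Q *ᵥ (g ∘ Sum.inl)))
      (P *ᵥ (g ∘ Sum.inr) - (D⁻¹ * Cᴴ) *ᵥ (W *ᵥ (Q *ᵥ (g ∘ Sum.inl)))) := fun g => by
    simp only [F, Matrix.fromBlocks_mulVec, Matrix.zero_mulVec, add_zero, Matrix.mulVec_mulVec,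
      Matrix.neg_mulVec, Matrix.mul_assoc]
    rw [neg_add_eq_sub]
  have key := card_le_of_form hV1 hV2 lam hH x F ?_ ?_
  · rw [Fintype.card_sum, Fintype.card_subtype, Fintype.card_subtype] at key
    exact key
  · intro g hg
    rw [hFg, ← Sum.elim_zero_zero, Sum.elim_eq_iff] at hg
    obtain ⟨ha, hb⟩ := hg
    rw [ha, Matrix.mulVec_zero, sub_zero] at hb
    have ha' : g ∘ Sum.inl = 0 := by
      rw [← normSqVec_eq_zero, ← normSqVec_mulVec hQ, ← normSqVec_mulVec hW1, ha,
        normSqVec_eq_zero]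
    have hb' : g ∘ Sum.inr = 0 := by
      rw [← normSqVec_eq_zero, ← normSqVec_mulVec hP, hb, normSqVec_eq_zero]
    funext i
    cases i with
    | inl i => exact congrFun ha' i
    | inr i => exact congrFun hb' i
  · intro g
    have hsplit : Matrix.fromBlocks E₁₁ C Cᴴ (L + E₂₂) =
        Matrix.fromBlocks (E₁₁ - (x : ℂ) • 1) C Cᴴ D + (x : ℂ) • 1 := by
      rw [← Matrix.fromBlocks_one, Matrix.fromBlocks_smul, Matrix.fromBlocks_add]
      have : L + E₂₂ = D + (x : ℂ) • 1 := by rw [hD, hNdef, add_assoc, sub_add_cancel]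
      simp [this]
    rw [hsplit, Matrix.add_mulVec, dotProduct_add, Complex.add_re, Matrix.smul_mulVec,
      Matrix.one_mulVec, dotProduct_smul, star_dotProduct_self, smul_eq_mul, ← Complex.ofReal_mul,
      Complex.ofReal_re, le_add_iff_nonneg_left, hFg]
    set q := Q *ᵥ (g ∘ Sum.inl) with hq
    set a := W *ᵥ q with ha
    set b := P *ᵥ (g ∘ Sum.inr) with hb
    rw [Matrix.dotProduct_mulVec, Matrix.schur_complement_eq₂₂ _ _ _ _ hDh, add_sub_cancel,
      Complex.add_re, ← Matrix.dotProduct_mulVec, ← Matrix.dotProduct_mulVec]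
    refine add_nonneg ?_ ?_
    -- On the support of `b` the diagonal part is at least `δ`, and `N` takes away at most `δ / 2`.
    · rw [hD, Matrix.add_mulVec, dotProduct_add, Complex.add_re]
      have h1 := mul_normSqVec_le_diagonal_form τ δ b fun i hi =>
        submatrix_one_mulVec_apply_of_not _ _ fun hpos => by
          have := hτ i
          rw [abs_of_pos hpos] at this
          linarith
      have h2 := (abs_le.1 (abs_re_form_le N b)).1
      have h3 := mul_le_mul_of_nonneg_right hNδ (normSqVec_nonneg b)
      have h4 := mul_nonneg hδ.le (normSqVec_nonneg b)
      rw [← hL] at h1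
      linarith
    -- On `a` the form of `B̃ - x` is at least `ε`, which absorbs the error of replacing `D⁻¹` by
    -- `L⁻¹`.
    · have hS : E₁₁ - (x : ℂ) • 1 - C * D⁻¹ * Cᴴ =
          W * (Matrix.diagonal fun i => (β i : ℂ)) * Wᴴ - (x : ℂ) • 1 -
            C * (D⁻¹ - L⁻¹) * Cᴴ := by
        rw [← hB, Matrix.mul_sub, Matrix.sub_mul]
        abel
      have hR : ‖C * (D⁻¹ - L⁻¹) * Cᴴ‖ ≤ ε := by
        calc ‖C * (D⁻¹ - L⁻¹) * Cᴴ‖ ≤ ‖C‖ * ‖D⁻¹ - L⁻¹‖ * ‖Cᴴ‖ :=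
              (Matrix.l2_opNorm_mul _ _).trans (by gcongr; exact Matrix.l2_opNorm_mul _ _)
          _ ≤ e * (2 / δ ^ 2 * (4 * e)) * e := by
              gcongr
              exact hDn.trans (by gcongr)
          _ = ε := by rw [hε]; ring
      have h1 : β j * normSqVec a ≤
          (star a ⬝ᵥ ((W * (Matrix.diagonal fun i => (β i : ℂ)) * Wᴴ) *ᵥ a)).re := by
        have e1 : Wᴴ * (W * (Matrix.diagonal fun i => (β i : ℂ))) * Wᴴ * W =
            Matrix.diagonal fun i => (β i : ℂ) := by
          rw [Matrix.mul_assoc, hW1, Matrix.mul_one, ← Matrix.mul_assoc, hW1, Matrix.one_mul]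
        rw [ha, normSqVec_mulVec hW1, star_mulVec_dotProduct, Matrix.mulVec_mulVec,
          Matrix.mulVec_mulVec, ← Matrix.mul_assoc, e1]
        exact mul_normSqVec_le_diagonal_form β _ q fun i hi =>
          submatrix_one_mulVec_apply_of_not _ _ (not_le.2 hi)
      have h2 := (abs_le.1 (abs_re_form_le (C * (D⁻¹ - L⁻¹) * Cᴴ) a)).2
      have h3 := mul_le_mul_of_nonneg_right hR (normSqVec_nonneg a)
      rw [hS, Matrix.sub_mulVec, Matrix.sub_mulVec, dotProduct_sub, dotProduct_sub,
        Complex.sub_re, Complex.sub_re, Matrix.smul_mulVec, Matrix.one_mulVec, dotProduct_smul,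
        star_dotProduct_self, smul_eq_mul, ← Complex.ofReal_mul, Complex.ofReal_re]
      have h4 : x * normSqVec a = β j * normSqVec a - ε * normSqVec a := by rw [hx]; ring
      linarith

/-! ### Uniform spectral gap near `A₀`. -/

theorem exists_unitary_diag {ι : Type*} [Fintype ι] [DecidableEq ι] {H : Matrix ι ι ℂ}
    (hH : H.IsHermitian) : ∃ X : Matrix ι ι ℂ, Xᴴ * X = 1 ∧ X * Xᴴ = 1 ∧
      H = X * (Matrix.diagonal fun i => (hH.eigenvalues i : ℂ)) * Xᴴ := by
  refine ⟨hH.eigenvectorUnitary, (Matrix.mem_unitaryGroup_iff').1 hH.eigenvectorUnitary.2,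
    (Matrix.mem_unitaryGroup_iff).1 hH.eigenvectorUnitary.2, ?_⟩
  conv_lhs => rw [hH.spectral_theorem]
  rfl

/-- A Hermitian `A` close to `A₀` having `0` as an eigenvalue with the multiplicity it has for `A₀`
has all its other eigenvalues uniformly away from zero. -/
theorem exists_gap {n m : ℕ} {A₀ : Matrix (Fin n) (Fin n) ℂ} (hA₀ : A₀.IsHermitian)
    (hrank : A₀.rank = m) :
    ∃ δ > 0, ∀ A : Matrix (Fin n) (Fin n) ℂ, ‖A - A₀‖ < δ →
      ∀ (U : Matrix (Fin n) (Fin (n - m) ⊕ Fin m) ℂ) (τ : Fin m → ℝ),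
        IsSpectralDecomp A U τ → ∀ i, δ ≤ |τ i| := by
  obtain ⟨d, hd0, hd⟩ : ∃ d > 0, ∀ i, hA₀.eigenvalues i ≠ 0 → 2 * d < |hA₀.eigenvalues i| := by
    by_cases hne : (Finset.univ.filter fun i => hA₀.eigenvalues i ≠ 0).Nonempty
    · obtain ⟨i₀, hi₀, hmin⟩ := Finset.exists_min_image _ (fun i => |hA₀.eigenvalues i|) hne
      have : 0 < |hA₀.eigenvalues i₀| := abs_pos.2 (Finset.mem_filter.1 hi₀).2
      refine ⟨|hA₀.eigenvalues i₀| / 3, by positivity, fun i hi => ?_⟩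
      have := hmin i (by simpa using hi)
      linarith
    · refine ⟨1, one_pos, fun i hi => absurd ⟨i, by simpa using hi⟩ hne⟩
  refine ⟨d, hd0, fun A hA U τ ⟨hU1, hU2, hUA⟩ i => ?_⟩
  by_contra hlt
  rw [not_le] at hlt
  obtain ⟨X, hX1, hX2, hX⟩ := exists_unitary_diag hA₀
  -- Squaring turns smallness of `|λ|` into a one-sided condition, and the sign fits
  -- `card_le_of_form`. If `|τ i| < d`, the zero columns of `U` together with column `i` span a
  -- space of dimension `n - m + 1` on which `‖A₀ v‖ ≤ 2d ‖v‖`, but only `n - m` eigenvalues of `A₀`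
  -- satisfy `|λ| ≤ 2d`.
  have hsq : -(A₀ᴴ * A₀) =
      X * (Matrix.diagonal fun i => ((-(hA₀.eigenvalues i) ^ 2 : ℝ) : ℂ)) * Xᴴ := by
    rw [hA₀.eq]
    conv_lhs => rw [hX]
    have : X * (Matrix.diagonal fun i => (hA₀.eigenvalues i : ℂ)) * Xᴴ *
        (X * (Matrix.diagonal fun i => (hA₀.eigenvalues i : ℂ)) * Xᴴ) =
        X * (Matrix.diagonal (fun i => (hA₀.eigenvalues i : ℂ)) * (Xᴴ * X) *
          Matrix.diagonal fun i => (hA₀.eigenvalues i : ℂ)) * Xᴴ := by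
      simp only [Matrix.mul_assoc]
    rw [this, hX1, Matrix.mul_one, Matrix.diagonal_mul_diagonal, ← Matrix.neg_mul,
      ← Matrix.mul_neg, Matrix.diagonal_neg]
    congr 3
    funext k
    simp [sq]
  let p : Fin (n - m) ⊕ Fin m → Prop := fun k => k = Sum.inr i ∨ k.isLeft
  let P : Matrix (Fin (n - m) ⊕ Fin m) {k // p k} ℂ :=
    (1 : Matrix _ _ ℂ).submatrix id Subtype.val
  have hP : Pᴴ * P = 1 := submatrix_one_isometry Subtype.val_injective
  have hUP : (U * P)ᴴ * (U * P) = 1 := by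
    rw [Matrix.conjTranspose_mul, Matrix.mul_assoc, ← Matrix.mul_assoc Uᴴ, hU1, Matrix.one_mul, hP]
  let T : Fin (n - m) ⊕ Fin m → ℝ := Sum.elim (fun _ => 0) τ
  have hT : (Matrix.fromBlocks 0 0 0 (Matrix.diagonal fun i => (τ i : ℂ)) :
      Matrix (Fin (n - m) ⊕ Fin m) (Fin (n - m) ⊕ Fin m) ℂ) =
      Matrix.diagonal fun k => (T k : ℂ) := by
    rw [← Matrix.diagonal_zero, Matrix.fromBlocks_diagonal]
    congr 1
    funext k
    cases k <;> simp [T]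
  have key := card_le_of_form hX1 hX2 _ hsq (-(2 * d) ^ 2) (U * P) ?_ ?_
  · have h1 : Fintype.card {k // p k} = n - m + 1 := by
      rw [Fintype.card_subtype]
      have : (Finset.univ.filter p) = Finset.cons (Sum.inr i)
          (Finset.univ.map Function.Embedding.inl) (by simp) := by
        ext k
        cases k <;> simp [p]
      rw [this]
      simp
    have h2 : (Finset.univ.filter fun k => -(2 * d) ^ 2 ≤ -(hA₀.eigenvalues k) ^ 2) ⊆
        Finset.univ.filter fun k => ¬ hA₀.eigenvalues k ≠ 0 := by
      intro k hk
      simp only [Finset.mem_filter, Finset.mem_univ, true_and] at hk ⊢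
      intro hk0
      have := hd k hk0
      rw [← sq_abs (hA₀.eigenvalues k)] at hk
      nlinarith
    have h3 := Finset.card_le_card h2
    have h4 := hA₀.rank_eq_card_non_zero_eigs
    rw [hrank, Fintype.card_subtype] at h4
    have h5 := Finset.card_filter_add_card_filter_not (s := Finset.univ) fun k => hA₀.eigenvalues k ≠ 0
    rw [Finset.card_univ, Fintype.card_fin] at h5
    omega
  · intro g hg
    rw [← normSqVec_eq_zero, ← normSqVec_mulVec hUP, hg, normSqVec_eq_zero]
  · intro g
    have hform : (star ((U * P) *ᵥ g) ⬝ᵥ (-(A₀ᴴ * A₀) *ᵥ ((U * P) *ᵥ g))).re =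
        -normSqVec (A₀ *ᵥ ((U * P) *ᵥ g)) := by
      rw [Matrix.neg_mulVec, dotProduct_neg, ← Matrix.mulVec_mulVec _ A₀ᴴ, ← star_mulVec_dotProduct,
        star_dotProduct_self, Complex.neg_re, Complex.ofReal_re]
    rw [hform, neg_mul, neg_le_neg_iff]
    set v := (U * P) *ᵥ g with hv
    have hvU : v = U *ᵥ (P *ᵥ g) := by rw [hv, Matrix.mulVec_mulVec]
    have h1 : ‖WithLp.toLp 2 (A *ᵥ v)‖ ≤ d * ‖WithLp.toLp 2 v‖ := by
      refine le_of_sq_le_sq ?_ (by positivity)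
      have hAv : A *ᵥ v = U *ᵥ ((Matrix.diagonal fun k => (T k : ℂ)) *ᵥ (P *ᵥ g)) := by
        rw [hUA, hT, hvU, Matrix.mulVec_mulVec _ _ U, Matrix.mul_assoc, hU1, Matrix.mul_one,
          Matrix.mulVec_mulVec _ U]
      rw [mul_pow, ← normSqVec_eq_norm_sq, ← normSqVec_eq_norm_sq, hAv, hvU, normSqVec_mulVec hU1,
        normSqVec_mulVec hU1, normSqVec, normSqVec, Finset.mul_sum]
      refine Finset.sum_le_sum fun k _ => ?_
      rw [Matrix.mulVec_diagonal, norm_mul, mul_pow, Complex.norm_real, Real.norm_eq_abs]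
      by_cases hk : p k
      · gcongr
        rcases hk with rfl | hk
        · exact hlt.le
        · obtain ⟨k, rfl⟩ := Sum.isLeft_iff.1 hk
          simpa [T] using hd0.le
      · rw [submatrix_one_mulVec_apply_of_not p g hk]
        simp
    have h2 : ‖WithLp.toLp 2 (A₀ *ᵥ v)‖ ≤ 2 * d * ‖WithLp.toLp 2 v‖ := by
      have h3 : ‖WithLp.toLp 2 ((A - A₀) *ᵥ v)‖ ≤ ‖A - A₀‖ * ‖WithLp.toLp 2 v‖ :=
        Matrix.l2_opNorm_mulVec (A - A₀) (WithLp.toLp 2 v)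
      have h4 : WithLp.toLp 2 (A₀ *ᵥ v) =
          WithLp.toLp 2 (A *ᵥ v) - WithLp.toLp 2 ((A - A₀) *ᵥ v) := by
        rw [← WithLp.toLp_sub, Matrix.sub_mulVec, sub_sub_cancel]
      have h5 := norm_sub_le (WithLp.toLp 2 (A *ᵥ v)) (WithLp.toLp 2 ((A - A₀) *ᵥ v))
      rw [← h4] at h5
      have h6 := mul_le_mul_of_nonneg_right hA.le (norm_nonneg (WithLp.toLp 2 v))
      linarith
    rw [normSqVec_eq_norm_sq, normSqVec_eq_norm_sq, ← mul_pow]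
    exact pow_le_pow_left₀ (norm_nonneg _) h2 2

end HermPert

/-! ### Assembly of the main theorem. -/

theorem mainTheorem8 (n m : ℕ) (A₀ : Matrix (Fin n) (Fin n) ℂ) (hA₀ : A₀.IsHermitian)
    (hrank : A₀.rank = m) :
    ∃ rA rE c : ℝ, 0 < rA ∧ 0 < rE ∧ 0 < c ∧
      ∀ (A : Matrix (Fin n) (Fin n) ℂ) (hA : A.IsHermitian), A.rank = m → ‖A - A₀‖ < rA →
      ∀ (E : Matrix (Fin n) (Fin n) ℂ) (hE : E.IsHermitian), ‖E‖ < rE →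
      ∀ (U : Matrix (Fin n) (Fin (n - m) ⊕ Fin m) ℂ) (τ : Fin m → ℝ),
        HermPert.IsSpectralDecomp A U τ →
        ∃ σ : Equiv.Perm (Fin n), ∀ j : Fin (n - m),
          |(hA.add hE).eigenvalues (σ (Fin.castLE (Nat.sub_le n m) j)) -
              (HermPert.isHermitian_tildeB U τ hE).eigenvalues j| ≤ c * ‖E‖ ^ 3 ∧
          (E ≠ 0 →
            |(hA.add hE).eigenvalues (σ (Fin.castLE (Nat.sub_le n m) j)) -
              (HermPert.isHermitian_tildeB U τ hE).eigenvalues j| < c * ‖E‖ ^ 3) := by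
  have hmn : m ≤ n := by
    have := A₀.rank_le_width
    omega
  obtain ⟨δ, hδ, hgap⟩ := HermPert.exists_gap hA₀ hrank
  -- The count gives `8 / δ ^ 2`; the slack up to `9 / δ ^ 2` makes the inequality strict for `E ≠
  -- 0`.
  refine ⟨δ, δ / 8, 9 / δ ^ 2, hδ, by positivity, by positivity, ?_⟩
  intro A hA _ hAA₀ E hE hEr U τ hU
  have hτ := hgap A hAA₀ U τ hU
  obtain ⟨hU1, hU2, hUA⟩ := hU
  obtain ⟨X, hX1, hX2, hX⟩ := HermPert.exists_unitary_diag (hA.add hE)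
  obtain ⟨W, hW1, -, hW⟩ :=
    HermPert.exists_unitary_diag (HermPert.isHermitian_tildeB U τ hE)
  set lam := (hA.add hE).eigenvalues
  set β := (HermPert.isHermitian_tildeB U τ hE).eigenvalues
  set M := HermPert.hatE U E with hM
  have hMh : M.IsHermitian := Matrix.isHermitian_conjTranspose_mul_mul U hE
  have hMn : ‖M‖ ≤ ‖E‖ := by
    have h1 := HermPert.norm_le_one_of_isometry hU1
    have h2 := h1
    rw [← Matrix.l2_opNorm_conjTranspose] at h2
    calc ‖Uᴴ * E * U‖ ≤ ‖Uᴴ‖ * ‖E‖ * ‖U‖ :=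
          (Matrix.l2_opNorm_mul _ _).trans (by gcongr; exact Matrix.l2_opNorm_mul _ _)
      _ ≤ 1 * ‖E‖ * 1 := by gcongr
      _ = ‖E‖ := by ring
  have h₁₁ : ‖M.toBlocks₁₁‖ ≤ ‖E‖ :=
    (HermPert.norm_submatrix_le M Sum.inl_injective Sum.inl_injective).trans hMn
  have h₁₂ : ‖M.toBlocks₁₂‖ ≤ ‖E‖ :=
    (HermPert.norm_submatrix_le M Sum.inl_injective Sum.inr_injective).trans hMn
  have h₂₂ : ‖M.toBlocks₂₂‖ ≤ ‖E‖ :=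
    (HermPert.norm_submatrix_le M Sum.inr_injective Sum.inr_injective).trans hMn
  have hh₂₂ : M.toBlocks₂₂.IsHermitian := hMh.submatrix Sum.inr
  have h₂₁ : M.toBlocks₂₁ = M.toBlocks₁₂ᴴ := by
    ext i j
    exact (hMh.apply (Sum.inr i) (Sum.inl j)).symm
  have hV1 : (Uᴴ * X)ᴴ * (Uᴴ * X) = 1 := by
    rw [Matrix.conjTranspose_mul, Matrix.conjTranspose_conjTranspose, Matrix.mul_assoc,
      ← Matrix.mul_assoc U, hU2, Matrix.one_mul, hX1]
  have hV2 : (Uᴴ * X) * (Uᴴ * X)ᴴ = 1 := by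
    rw [Matrix.conjTranspose_mul, Matrix.conjTranspose_conjTranspose, Matrix.mul_assoc,
      ← Matrix.mul_assoc X, hX2, Matrix.one_mul, hU1]
  have hH : Matrix.fromBlocks M.toBlocks₁₁ M.toBlocks₁₂ M.toBlocks₁₂ᴴ
      ((Matrix.diagonal fun i => (τ i : ℂ)) + M.toBlocks₂₂) =
      (Uᴴ * X) * (Matrix.diagonal fun i => (lam i : ℂ)) * (Uᴴ * X)ᴴ := by
    have e1 : (Uᴴ * X) * (Matrix.diagonal fun i => (lam i : ℂ)) * (Uᴴ * X)ᴴ =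
        Uᴴ * (A + E) * U := by
      rw [hX, Matrix.conjTranspose_mul, Matrix.conjTranspose_conjTranspose]
      simp only [Matrix.mul_assoc]
    have e2 : Uᴴ * A * U = Matrix.fromBlocks 0 0 0 (Matrix.diagonal fun i => (τ i : ℂ)) := by
      rw [hUA, Matrix.mul_assoc, Matrix.mul_assoc, hU1, Matrix.mul_one, ← Matrix.mul_assoc, hU1,
        Matrix.one_mul]
    have e3 : Uᴴ * E * U = Matrix.fromBlocks M.toBlocks₁₁ M.toBlocks₁₂ M.toBlocks₁₂ᴴ
        M.toBlocks₂₂ := by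
      rw [← h₂₁, Matrix.fromBlocks_toBlocks]
      rfl
    rw [e1, Matrix.mul_add, Matrix.add_mul, e2, e3, Matrix.fromBlocks_add]
    simp
  have hinvneg : (Matrix.diagonal fun i => ((-τ i : ℝ) : ℂ))⁻¹ =
      -(Matrix.diagonal fun i => (τ i : ℂ))⁻¹ := by
    have h0 : IsUnit (Matrix.diagonal fun i => (τ i : ℂ)).det := by
      rw [Matrix.det_diagonal, isUnit_iff_ne_zero, Finset.prod_ne_zero_iff]
      intro i _ h
      have := hτ i
      rw [Complex.ofReal_eq_zero.1 h, abs_zero] at this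
      linarith
    apply Matrix.inv_eq_right_inv
    have : (Matrix.diagonal fun i => ((-τ i : ℝ) : ℂ)) = -Matrix.diagonal fun i => (τ i : ℂ) := by
      rw [Matrix.diagonal_neg]
      simp
    rw [this, neg_mul_neg, Matrix.mul_nonsing_inv _ h0]
  have hdiag : ∀ {k : ℕ} (d : Fin k → ℝ), (Matrix.diagonal fun i => ((-d i : ℝ) : ℂ)) =
      -Matrix.diagonal fun i => (d i : ℂ) := by
    intro k d
    rw [Matrix.diagonal_neg]
    simp
  have hge := HermPert.card_add_card_pos_le hδ hτ (norm_nonneg E) hEr.le h₁₁ h₁₂ h₂₂ hh₂₂ hW1 hW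
    hV1 hV2 hH
  -- Negating `Λ` and all blocks of `Ê` negates `B̃` and the eigenvalues, so the same lemma yields
  -- the upper bounds, now counting the negative `τ i`.
  have hle := HermPert.card_add_card_pos_le (E₁₁ := -M.toBlocks₁₁) (C := -M.toBlocks₁₂)
    (E₂₂ := -M.toBlocks₂₂) (τ := fun i => -τ i) (β := fun i => -β i) (lam := fun i => -lam i)
    (W := W) hδ (fun i => by rw [abs_neg]; exact hτ i) (norm_nonneg E) hEr.le
    (by rwa [norm_neg]) (by rwa [norm_neg]) (by rwa [norm_neg]) hh₂₂.neg hW1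
    (by
      rw [hinvneg, hdiag β, Matrix.mul_neg W, Matrix.neg_mul _ Wᴴ, ← hW, Matrix.conjTranspose_neg]
      simp only [Matrix.neg_mul, Matrix.mul_neg, neg_neg]
      rw [HermPert.tildeB, neg_sub, sub_neg_eq_add, neg_add_eq_sub]
      rfl)
    hV1 hV2
    (by
      rw [hdiag lam, Matrix.mul_neg, Matrix.neg_mul _ (Uᴴ * X)ᴴ, ← hH, hdiag τ, ← neg_add,
        Matrix.conjTranspose_neg, Matrix.fromBlocks_neg])
  have hpq : Finset.card {i | τ i < 0} + Finset.card {i | 0 < τ i} + (n - m) = n := by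
    have h1 := Finset.card_filter_add_card_filter_not (s := Finset.univ) fun i => 0 < τ i
    have h2 : (Finset.univ.filter fun i => ¬ 0 < τ i) = Finset.univ.filter fun i => τ i < 0 := by
      refine Finset.filter_congr fun i _ => ?_
      have h3 : τ i ≠ 0 := fun h => by
        have := hτ i
        rw [h, abs_zero] at this
        linarith
      rw [not_lt]
      exact ⟨fun h => lt_of_le_of_ne h h3, le_of_lt⟩
    rw [h2, Finset.card_univ, Fintype.card_fin] at h1
    omega
  obtain ⟨σ, hσ⟩ := HermPert.exists_perm_of_card_le (Nat.sub_le n m) hpq lam β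
    (8 / δ ^ 2 * ‖E‖ ^ 3) hge fun j => by
      have := hle j
      simp only [neg_le_neg_iff, Left.neg_pos_iff, neg_sub_left] at this
      refine this.trans (Finset.card_le_card fun i hi => ?_)
      simp only [Finset.mem_filter, Finset.mem_univ, true_and] at hi ⊢
      linarith
  have hc : 8 / δ ^ 2 < 9 / δ ^ 2 := by gcongr; norm_num
  refine ⟨σ, fun j => ⟨(hσ j).trans (by gcongr), fun hE0 => (hσ j).trans_lt ?_⟩⟩
  have : 0 < ‖E‖ := norm_pos_iff.2 hE0
  gcongr
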